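/- All graphs are finite and simple. Let $t \ge 2$ and let $G$ be a graph with vertex set $\{1,\dots,n\}$. The $t$-clique tensor $A_t(G) = (a_{i_1 i_2\cdots i_t})$ of $G$ is the tensor of order $t$ and dimension $n$ with $a_{i_1\cdots i_t} = \frac{1}{(t-1)!}$ if $\{i_1,\dots,i_t\}$ is a clique of $G$ with exactly $t$ vertices, and $a_{i_1\cdots i_t} = 0$ otherwise. A complex number $\lambda$ is an eigenvalue of $A_t(G)$ if there is a nonzero vector $x \in \mathbb{C}^n$ with $$\sum_{i_2,\dots,i_t=1}^n a_{i i_2\cdots i_t}\, x_{i_2}\cdots x_{i_t} = \lambda\, x_i^{t-1}\qquad (i = 1,\dots,n).$$ The $t$-clique spectral radius $\rho_t(G)$ is the maximum modulus of an eigenvalue of $A_t(G)$. Let $P_k$ be the path on $k$ vertices and $K_m$ the complete graph on $m$ vertices; a graph is $P_k$-free if it contains no (not necessarily induced) subgraph isomorphic to $P_k$. **Theorem.** Let $n, k, t$ be integers with $n \ge k-1$ and $2 \le \lfloor \frac{k+1}{2} \rfloor < t < k$. Then every $P_k$-free graph $G$ on $n$ vertices satisfies $$\rho_t(G) \le \rho_t(K_{k-1}).$$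 -/

import Mathlib

namespace CliqueSpectral

/-- A complex tensor of order `t` (where `1 ≤ t`) with index set `ι`. The entry
`h_{i₁ i₂ ⋯ i_t}` is `H i₁ j`, where `j : Fin (t - 1) → ι` lists `i₂, …, i_t`. -/
abbrev Tensor (t : ℕ) (ι : Type*) : Type _ := ι → (Fin (t - 1) → ι) → ℂ

/-- The vector `H x^{t-1}`, whose `i`-th component is
`∑_{i₂, …, i_t} h_{i i₂ ⋯ i_t} x_{i₂} ⋯ x_{i_t}`. -/
def Tensor.apply {t : ℕ} {ι : Type*} [Fintype ι] (H : Tensor t ι) (x : ι → ℂ) : ι → ℂ :=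
  fun i => ∑ j : Fin (t - 1) → ι, H i j * ∏ r, x (j r)

/-- `lam` is an eigenvalue of `H`: there is `x ≠ 0` with `H x^{t-1} = lam x^{[t-1]}`. -/
def Tensor.IsEigenvalue {t : ℕ} {ι : Type*} [Fintype ι] (H : Tensor t ι) (lam : ℂ) : Prop :=
  ∃ x : ι → ℂ, x ≠ 0 ∧ ∀ i, H.apply x i = lam * x i ^ (t - 1)

/-- The spectral radius: the largest modulus of an eigenvalue
(see `Tensor.isGreatest_spectralRadius`). -/
noncomputable def Tensor.spectralRadius {t : ℕ} {ι : Type*} [Fintype ι] (H : Tensor t ι) : ℝ :=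
  sSup {r : ℝ | ∃ lam : ℂ, H.IsEigenvalue lam ∧ r = ‖lam‖}

open Classical in
/-- The `t`-clique tensor of `G`: the entry at `i₁, …, i_t` is `1 / (t-1)!` if
`{i₁, …, i_t}` is a clique of size `t`, and `0` otherwise. -/
noncomputable def cliqueTensor {V : Type*} (t : ℕ) (G : SimpleGraph V) : Tensor t V :=
  fun i j =>
    if G.IsNClique t (insert i (Finset.univ.image j)) then 1 / ((t - 1).factorial : ℂ) else 0

/-- The `t`-clique spectral radius `ρ_t(G)`. -/
noncomputable def cliqueSpectralRadius {V : Type*} [Fintype V] (t : ℕ) (G : SimpleGraph V) : ℝ :=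
  (cliqueTensor t G).spectralRadius

/-- An eigenvalue has an eigenvector of sup norm one. -/
theorem Tensor.IsEigenvalue.exists_norm_eq_one {t : ℕ} {ι : Type*} [Fintype ι] {H : Tensor t ι}
    {lam : ℂ} (h : H.IsEigenvalue lam) :
    ∃ x : ι → ℂ, ‖x‖ = 1 ∧ ∀ i, H.apply x i = lam * x i ^ (t - 1) := by
  obtain ⟨x, hx, he⟩ := h
  have hn : ‖x‖ ≠ 0 := by simpa using hx
  refine ⟨((‖x‖⁻¹ : ℝ) : ℂ) • x, ?_, fun i => ?_⟩
  · rw [norm_smul]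
    simp [hn]
  · have h1 : H.apply (((‖x‖⁻¹ : ℝ) : ℂ) • x) i =
        (((‖x‖⁻¹ : ℝ) : ℂ)) ^ (t - 1) * H.apply x i := by
      simp only [Tensor.apply, Pi.smul_apply, smul_eq_mul, Finset.prod_mul_distrib,
        Finset.prod_const, Finset.card_univ, Fintype.card_fin, Finset.mul_sum]
      exact Finset.sum_congr rfl fun j _ => by ring
    rw [h1, he i, Pi.smul_apply, smul_eq_mul, mul_pow]
    ring

/-- Every eigenvalue is bounded by the sum of the moduli of the entries. -/
theorem Tensor.IsEigenvalue.norm_le {t : ℕ} {ι : Type*} [Fintype ι] {H : Tensor t ι}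
    {lam : ℂ} (h : H.IsEigenvalue lam) : ‖lam‖ ≤ ∑ i, ∑ j, ‖H i j‖ := by
  obtain ⟨x, hx, he⟩ := h.exists_norm_eq_one
  have hne : Nonempty ι := by
    by_contra hc
    rw [not_nonempty_iff] at hc
    have : x = 0 := Subsingleton.elim _ _
    simp [this] at hx
  obtain ⟨i, hmax⟩ := Finite.exists_max fun i => ‖x i‖
  have hi : ‖x i‖ = ‖x‖ :=
    le_antisymm (norm_le_pi_norm x i) ((pi_norm_le_iff_of_nonneg (norm_nonneg _)).2 hmax)
  have h1 : ‖lam‖ = ‖H.apply x i‖ := by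
    rw [he i, norm_mul, norm_pow, hi, hx, one_pow, mul_one]
  have h2 : ‖H.apply x i‖ ≤ ∑ j, ‖H i j‖ := by
    refine (norm_sum_le _ _).trans (Finset.sum_le_sum fun j _ => ?_)
    rw [norm_mul, norm_prod]
    refine mul_le_of_le_one_right (norm_nonneg _) ?_
    exact Finset.prod_le_one (fun r _ => norm_nonneg _)
      fun r _ => (norm_le_pi_norm x (j r)).trans hx.le
  rw [h1]
  refine h2.trans ?_
  exact Finset.single_le_sum (f := fun i => ∑ j, ‖H i j‖)
    (fun i _ => Finset.sum_nonneg fun j _ => norm_nonneg _) (Finset.mem_univ i)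

/-- The maximum in the definition of the spectral radius exists. -/
theorem Tensor.isGreatest_spectralRadius {t : ℕ} {ι : Type*} [Fintype ι] (H : Tensor t ι)
    (hH : ∃ lam : ℂ, H.IsEigenvalue lam) :
    IsGreatest {r : ℝ | ∃ lam : ℂ, H.IsEigenvalue lam ∧ r = ‖lam‖} H.spectralRadius := by
  obtain ⟨lam₀, h₀⟩ := hH
  set C : ℝ := ∑ i, ∑ j, ‖H i j‖ with hC
  let K : Set (ℂ × (ι → ℂ)) := Metric.closedBall 0 C ×ˢ Metric.sphere 0 1
  let F : Set (ℂ × (ι → ℂ)) := {p | ∀ i, H.apply p.2 i = p.1 * p.2 i ^ (t - 1)}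
  have hK : IsCompact K := (isCompact_closedBall _ _).prod (isCompact_sphere _ _)
  have hF : IsClosed F := by
    have : F = ⋂ i, {p | H.apply p.2 i = p.1 * p.2 i ^ (t - 1)} := by
      ext p
      simp [F]
    rw [this]
    refine isClosed_iInter fun i => isClosed_eq ?_ (by fun_prop)
    simp only [Tensor.apply]
    fun_prop
  have hKF : IsCompact (K ∩ F) := hK.inter_right hF
  have hS : {r : ℝ | ∃ lam : ℂ, H.IsEigenvalue lam ∧ r = ‖lam‖} =
      (fun p : ℂ × (ι → ℂ) => ‖p.1‖) '' (K ∩ F) := by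
    ext r
    constructor
    · rintro ⟨lam, h, rfl⟩
      obtain ⟨x, hx, he⟩ := h.exists_norm_eq_one
      refine ⟨(lam, x), ⟨⟨?_, ?_⟩, he⟩, rfl⟩
      · simpa using h.norm_le
      · simpa using hx
    · rintro ⟨⟨lam, x⟩, ⟨⟨_, h2⟩, h3⟩, rfl⟩
      refine ⟨lam, ⟨x, ?_, h3⟩, rfl⟩
      rintro rfl
      simp at h2
  have hc : IsCompact {r : ℝ | ∃ lam : ℂ, H.IsEigenvalue lam ∧ r = ‖lam‖} := by
    rw [hS]
    exact hKF.image (by fun_prop)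
  exact hc.isGreatest_sSup ⟨_, lam₀, h₀, rfl⟩

end CliqueSpectral

/-! ### Long paths under a minimum degree condition. -/

namespace SimpleGraph

variable {V : Type*} {G : SimpleGraph V}

/-! At a coordinate of largest modulus, the eigenvalue equation bounds `‖lam‖` by the largest number
of `t`-cliques through a vertex. For `K_{k-1}` the all-ones vector attains this number,
`(k-2).choose (t-1)`, so it suffices that no vertex of `G` lies in more `t`-cliques.

Keep only the edges of `G` lying in `t`-cliques. Every non-isolated vertex now has degree at least
`t - 1`, and `exists_isChain_of_le_degree` gives a path on `min (2t-1) (d(v)+1)` vertices. As `2t -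
1 ≥ k`, being `P_k`-free forces `d(v) ≤ k - 2` for each `v` in a `t`-clique; the other vertices of a
clique through `v` are among these `d(v)` neighbours.

The path comes from a longest one through `v`: if it has at most `2δ` vertices, its vertex set
carries a cycle, and opening that cycle at `v` shows that it contains all neighbours of `v`. -/

theorem pathGraph_isContained_of_isChain {l : List V} (hc : l.IsChain G.Adj) (hl : l.Nodup)
    {k : ℕ} (hk : k ≤ l.length) : (pathGraph k).IsContained G := by
  rw [List.isChain_iff_getElem] at hc
  refine ⟨⟨⟨fun i => l[i.1]'(by omega), ?_⟩, ?_⟩⟩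
  · intro a b hab
    rcases pathGraph_adj.1 hab with h | h
    · have := hc a.1 (by omega)
      simpa only [h] using this
    · have := hc b.1 (by omega)
      simpa only [h] using this.symm
  · intro a b hab
    exact Fin.ext ((hl.getElem_inj_iff).1 hab)

/-- If a list closes up to a cycle through `v`, it extends by any new neighbour of `v`. -/
theorem exists_isChain_cons_of_cycle {l : List V} (hc : l.IsChain G.Adj)
    (hcyc : ∀ x ∈ l.getLast?, ∀ y ∈ l.head?, G.Adj x y) {v w : V} (hv : v ∈ l)
    (hw : G.Adj v w) : ∃ l' : List V, l'.Perm l ∧ (w :: l').IsChain G.Adj := by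
  obtain ⟨C, D, rfl⟩ := List.append_of_mem hv
  -- Cut the cycle just before `v`; the closing edge joins `D` to `C`.
  refine ⟨v :: D ++ C, List.perm_append_comm, ?_⟩
  have h1 := List.isChain_append.1 hc
  rw [List.cons_append, List.isChain_cons_cons, ← List.cons_append, List.isChain_append]
  refine ⟨hw.symm, h1.2.1, h1.1, fun x hx y hy => hcyc x ?_ y ?_⟩
  · rw [List.getLast?_append, Option.mem_def.1 hx]; rfl
  · rw [List.head?_append, Option.mem_def.1 hy]; rfl

variable [Fintype V] [DecidableRel G.Adj]

/-- The crossing argument of Ore and Dirac. -/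
theorem exists_cycle_of_degree_ends {l : List V} (hc : l.IsChain G.Adj) (hne : l ≠ [])
    (h1 : ∀ w, G.Adj (l.head hne) w → w ∈ l) (h2 : ∀ w, G.Adj (l.getLast hne) w → w ∈ l)
    (hd : l.length ≤ G.degree (l.head hne) + G.degree (l.getLast hne)) :
    ∃ l' : List V, l'.Perm l ∧ l'.IsChain G.Adj ∧
      ∀ x ∈ l'.getLast?, ∀ y ∈ l'.head?, G.Adj x y := by
  classical
  have hpos : 0 < l.length := List.length_pos_iff.2 hne
  -- The shift by one in `I` makes a common index `i` of `I` and `J` a crossing pair: the head sees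
  -- `l[i + 1]` and the last vertex sees `l[i]`. One exists, since only `l.length - 1` indices are
  -- available.
  let I := (Finset.range (l.length - 1)).filter fun i => ∃ h : i + 1 < l.length,
    G.Adj (l.head hne) l[i + 1]
  let J := (Finset.range (l.length - 1)).filter fun i => ∃ h : i < l.length,
    G.Adj (l.getLast hne) l[i]
  have hI : G.degree (l.head hne) ≤ I.card := by
    rw [← card_neighborFinset_eq_degree]
    -- The default value is never reached on `I`. Surjectivity avoids assuming that `l` has no
    -- repetitions.
    refine Finset.card_le_card_of_surjOn (fun i => l[i + 1]?.getD (l.head hne)) ?_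
    intro w hw
    have hw' : G.Adj (l.head hne) w := by simpa using hw
    obtain ⟨j, hj, rfl⟩ := List.getElem_of_mem (h1 w hw')
    obtain _ | j := j
    · exact absurd hw' (by rw [List.head_eq_getElem]; exact G.irrefl)
    · exact ⟨j, by simp [I]; exact ⟨by omega, hj, hw'⟩, by simp [hj]⟩
  have hJ : G.degree (l.getLast hne) ≤ J.card := by
    rw [← card_neighborFinset_eq_degree]
    refine Finset.card_le_card_of_surjOn (fun i => l[i]?.getD (l.head hne)) ?_
    intro w hw
    have hw' : G.Adj (l.getLast hne) w := by simpa using hw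
    obtain ⟨j, hj, rfl⟩ := List.getElem_of_mem (h2 w hw')
    have hj' : j ≠ l.length - 1 := by
      rintro rfl
      exact absurd hw' (by rw [List.getLast_eq_getElem]; exact G.irrefl)
    exact ⟨j, by simp [J]; exact ⟨by omega, hj, hw'⟩, by simp [hj]⟩
  have hIJ : ¬ Disjoint I J := by
    intro hdis
    have := Finset.card_le_card
      (Finset.union_subset (Finset.filter_subset _ _) (Finset.filter_subset _ _) :
        I ∪ J ⊆ Finset.range (l.length - 1))
    rw [Finset.card_union_of_disjoint hdis, Finset.card_range] at this
    omega
  obtain ⟨i, hiI, hiJ⟩ := Finset.not_disjoint_iff.1 hIJ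
  obtain ⟨-, hi, ha⟩ := Finset.mem_filter.1 hiI
  obtain ⟨-, hi', hb⟩ := Finset.mem_filter.1 hiJ
  have hsplit : l.take (i + 1) ++ l.drop (i + 1) = l := List.take_append_drop _ _
  have hc' := hc
  rw [← hsplit, List.isChain_append] at hc'
  have hlast : (l.take (i + 1)).getLast? = some l[i] := by
    simp [List.getLast?_eq_getElem?, List.length_take, hi']
  -- Reversing the tail uses the crossing edges as junction and closing edge.
  refine ⟨l.take (i + 1) ++ (l.drop (i + 1)).reverse, ?_, ?_, ?_⟩
  · conv_rhs => rw [← hsplit]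
    exact (List.reverse_perm _).append_left _
  · rw [List.isChain_append]
    refine ⟨hc'.1, ?_, ?_⟩
    · rw [List.isChain_reverse]
      exact hc'.2.1.imp fun _ _ h => h.symm
    · intro x hx y hy
      rw [hlast] at hx
      rw [List.head?_reverse, List.getLast?_drop, if_neg (by omega),
        List.getLast?_eq_some_getLast hne] at hy
      simp only [Option.mem_def, Option.some.injEq] at hx hy
      subst hx hy
      exact hb.symm
  · intro x hx y hy
    rw [List.getLast?_append, List.getLast?_reverse, List.head?_drop,
      List.getElem?_eq_getElem hi] at hx
    rw [List.head?_append, List.head?_take, if_neg (by omega),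
      List.head?_eq_some_head hne] at hy
    simp only [Option.mem_def, Option.some.injEq, Option.some_or] at hx hy
    subst hx hy
    exact ha.symm

/-- If all non-isolated vertices have degree at least `δ`, then there is a path on
`min (2 * δ + 1) (G.degree v + 1)` vertices. -/
theorem exists_isChain_of_le_degree {δ : ℕ} (h : ∀ u w, G.Adj u w → δ ≤ G.degree u)
    {v : V} (hv : δ ≤ G.degree v) :
    ∃ l : List V, l.IsChain G.Adj ∧ l.Nodup ∧
      min (2 * δ + 1) (G.degree v + 1) ≤ l.length := by
  classical
  -- The degree condition is carried along so that it holds at both ends, even for the one-vertex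
  -- path.
  let P : ℕ → Prop := fun m => ∃ l : List V, l.length = m ∧ l.IsChain G.Adj ∧ l.Nodup ∧ v ∈ l ∧
    ∀ u ∈ l, δ ≤ G.degree u
  have hP1 : P 1 := ⟨[v], rfl, .singleton _, by simp, by simp, by simpa using hv⟩
  have hbound : ∀ m, P m → m ≤ Fintype.card V := by
    rintro m ⟨l, rfl, -, hl, -⟩
    exact hl.length_le_card
  have hone : 1 ≤ Fintype.card V := hbound 1 hP1
  obtain ⟨l, hlen, hc, hnd, hvl, hdeg⟩ := Nat.findGreatest_spec (P := P) hone hP1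
  have hmax : ∀ (l' : List V) (w : V), l'.Perm l → (w :: l').IsChain G.Adj → w ∈ l := by
    intro l' w hp hcl
    by_contra hw
    have hne' : l' ≠ [] := by
      rintro rfl
      simp [List.nil_perm.1 hp] at hvl
    have hwd : δ ≤ G.degree w := by
      obtain ⟨a, L, rfl⟩ := List.exists_cons_of_ne_nil hne'
      exact h w a (List.isChain_cons_cons.1 hcl).1
    have hP : P (l.length + 1) := by
      refine ⟨w :: l', by simp [hp.length_eq], hcl, ?_, ?_, ?_⟩
      · exact List.nodup_cons.2 ⟨fun hh => hw (hp.mem_iff.1 hh), hp.nodup_iff.2 hnd⟩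
      · exact List.mem_cons_of_mem _ (hp.mem_iff.2 hvl)
      · intro u hu
        rcases List.mem_cons.1 hu with rfl | hu
        · exact hwd
        · exact hdeg u (hp.mem_iff.1 hu)
    have := Nat.le_findGreatest (P := P) (hbound _ hP) hP
    omega
  refine ⟨l, hc, hnd, ?_⟩
  by_contra! hlt
  obtain ⟨hlt1, hlt2⟩ := lt_min_iff.1 hlt
  have hne : l ≠ [] := List.ne_nil_of_mem hvl
  obtain ⟨l', hp, hc', hcyc⟩ := exists_cycle_of_degree_ends hc hne
    (fun w hw => hmax l w (.refl _) <| List.isChain_cons.2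
      ⟨fun y hy => by
        rw [List.head?_eq_some_head hne, Option.mem_def, Option.some.injEq] at hy
        exact hy ▸ hw.symm, hc⟩)
    (fun w hw => hmax l.reverse w (List.reverse_perm _) <| List.isChain_cons.2
      ⟨fun y hy => by
        rw [List.head?_reverse, List.getLast?_eq_some_getLast hne, Option.mem_def,
          Option.some.injEq] at hy
        exact hy ▸ hw.symm, List.isChain_reverse.2 (hc.imp fun _ _ h => h.symm)⟩)
    (by
      have := hdeg _ (List.head_mem hne)
      have := hdeg _ (List.getLast_mem hne)
      omega)
  -- A neighbour of `v` off the cycle would give a longer path.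
  have hsub : insert v (G.neighborFinset v) ⊆ l.toFinset := by
    refine Finset.insert_subset (List.mem_toFinset.2 hvl) fun w hw => List.mem_toFinset.2 ?_
    obtain ⟨l'', hp', hc''⟩ := exists_isChain_cons_of_cycle hc' hcyc (hp.mem_iff.2 hvl)
      (by simpa using hw : G.Adj v w)
    exact hmax l'' w (hp'.trans hp) hc''
  have hcard := Finset.card_le_card hsub
  rw [Finset.card_insert_of_notMem (by simp), card_neighborFinset_eq_degree,
    List.toFinset_card_of_nodup hnd] at hcard
  omega

end SimpleGraph

/-! ### Counting cliques through a vertex. -/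

namespace CliqueSpectral

open Finset

variable {V : Type*}

/-- The graph of all edges lying in a clique of size `t`. -/
def cliqueEdgeGraph (t : ℕ) (G : SimpleGraph V) : SimpleGraph V where
  Adj u w := u ≠ w ∧ ∃ s : Finset V, G.IsNClique t s ∧ u ∈ s ∧ w ∈ s
  symm := ⟨fun _ _ ⟨h, s, hs, hu, hw⟩ => ⟨h.symm, s, hs, hw, hu⟩⟩
  loopless := ⟨fun _ h => h.1 rfl⟩

theorem cliqueEdgeGraph_le (t : ℕ) (G : SimpleGraph V) : cliqueEdgeGraph t G ≤ G :=
  fun _ _ ⟨h, _, hs, hu, hw⟩ => hs.1 hu hw h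


open Classical in
theorem card_insert_image_eq_iff {t : ℕ} (ht : 1 ≤ t) {i : V} {j : Fin (t - 1) → V} :
    (insert i (univ.image j)).card = t ↔ Function.Injective j ∧ ∀ r, j r ≠ i := by
  have h1 : (univ.image j).card ≤ t - 1 := card_image_le.trans (by simp)
  have h2 : Function.Injective j ↔ (univ.image j).card = t - 1 := by
    rw [← Set.injOn_univ, ← coe_univ, ← card_image_iff]; simp
  rw [h2]
  by_cases hi : i ∈ univ.image j
  · rw [insert_eq_of_mem hi]
    obtain ⟨r, -, hr⟩ := mem_image.1 hi
    exact iff_of_false (by omega) fun h => h.2 r hr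
  · rw [card_insert_of_notMem hi]
    have : ∀ r, j r ≠ i := fun r hr => hi (mem_image.2 ⟨r, mem_univ _, hr⟩)
    simp only [ne_eq, this, not_false_eq_true, implies_true, and_true]
    omega

variable [Fintype V]

open Classical in
theorem le_degree_cliqueEdgeGraph {t : ℕ} {G : SimpleGraph V} {s : Finset V}
    (hs : G.IsNClique t s) {u : V} (hu : u ∈ s) : t - 1 ≤ (cliqueEdgeGraph t G).degree u := by
  rw [← SimpleGraph.card_neighborFinset_eq_degree, ← congrArg (· - 1) hs.2, ← card_erase_of_mem hu]
  refine card_le_card fun w hw => ?_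
  rw [SimpleGraph.mem_neighborFinset]
  exact ⟨(ne_of_mem_erase hw).symm, s, hs, hu, mem_of_mem_erase hw⟩

open Classical in
theorem degree_cliqueEdgeGraph_lt {k t : ℕ} (hkt : (k + 1) / 2 < t) {G : SimpleGraph V}
    (hG : (SimpleGraph.pathGraph k).Free G) {s : Finset V} (hs : G.IsNClique t s)
    {v : V} (hv : v ∈ s) : (cliqueEdgeGraph t G).degree v + 1 < k := by
  obtain ⟨l, hc, hnd, hlen⟩ := SimpleGraph.exists_isChain_of_le_degree
    (G := cliqueEdgeGraph t G) (δ := t - 1)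
    (fun u w ⟨_, s', hs', hu, _⟩ => le_degree_cliqueEdgeGraph hs' hu)
    (le_degree_cliqueEdgeGraph hs hv)
  by_contra! hk
  -- Both terms of the minimum reach `k`: `(k + 1) / 2 < t` gives `2 * (t - 1) + 1 ≥ k`.
  exact hG (SimpleGraph.pathGraph_isContained_of_isChain
    (hc.imp fun _ _ h => cliqueEdgeGraph_le t G h) hnd (by omega))

open Classical in
/-- The ordered cliques of size `t` with first vertex `i`, without their first vertex. -/
noncomputable def orderedCliques (t : ℕ) (G : SimpleGraph V) (i : V) : Finset (Fin (t - 1) → V) :=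
  univ.filter fun j => G.IsNClique t (insert i (univ.image j))

open Classical in
theorem mem_orderedCliques {t : ℕ} {G : SimpleGraph V} {i : V} {j : Fin (t - 1) → V} :
    j ∈ orderedCliques t G i ↔ G.IsNClique t (insert i (univ.image j)) := by
  simp [orderedCliques]

open Classical in
theorem card_orderedCliques_le {t : ℕ} (ht : 1 ≤ t) (G : SimpleGraph V) (i : V) :
    (orderedCliques t G i).card ≤ ((cliqueEdgeGraph t G).degree i).descFactorial (t - 1) := by
  have hcard : Fintype.card (Fin (t - 1) ↪ (cliqueEdgeGraph t G).neighborFinset i) =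
      ((cliqueEdgeGraph t G).degree i).descFactorial (t - 1) := by
    rw [Fintype.card_embedding_eq, Fintype.card_coe, SimpleGraph.card_neighborFinset_eq_degree,
      Fintype.card_fin]
  rw [← hcard, ← card_univ]
  refine card_le_card_of_surjOn (fun f r => (f r : V)) fun j hj => ?_
  have hj' := mem_orderedCliques.1 (mem_coe.1 hj)
  obtain ⟨hinj, hne⟩ := (card_insert_image_eq_iff ht).1 hj'.2
  refine ⟨⟨fun r => ⟨j r, ?_⟩, fun a b hab => hinj (congrArg Subtype.val hab)⟩, by simp, rfl⟩
  rw [SimpleGraph.mem_neighborFinset]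
  exact ⟨(hne r).symm, _, hj', mem_insert_self _ _,
    mem_insert_of_mem (mem_image_of_mem _ (mem_univ r))⟩

open Classical in
theorem card_orderedCliques_top {t : ℕ} (ht : 1 ≤ t) (i : V) :
    (orderedCliques t (⊤ : SimpleGraph V) i).card =
      (Fintype.card V - 1).descFactorial (t - 1) := by
  have hcard : Fintype.card (Fin (t - 1) ↪ {w : V // w ≠ i}) =
      (Fintype.card V - 1).descFactorial (t - 1) := by
    simp [Fintype.card_embedding_eq]
  rw [← hcard, ← card_univ]
  symm
  refine card_bij (fun f _ r => (f r : V)) ?_ ?_ ?_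
  · intro f _
    have hcl : (insert i (univ.image fun r => (f r : V))).card = t :=
      (card_insert_image_eq_iff ht).2
        ⟨Subtype.val_injective.comp f.injective, fun r => (f r).2⟩
    exact mem_orderedCliques.2 ⟨fun a _ b _ h => h, hcl⟩
  · intro f _ g _ hfg
    ext r
    exact congrFun hfg r
  · intro j hj
    obtain ⟨hinj, hne⟩ := (card_insert_image_eq_iff ht).1 (mem_orderedCliques.1 hj).card_eq
    exact ⟨⟨fun r => ⟨j r, hne r⟩, fun a b hab => hinj (congrArg Subtype.val hab)⟩, by simp, rfl⟩

/-! ### Eigenvalues of clique tensors. -/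

theorem apply_cliqueTensor (t : ℕ) (G : SimpleGraph V) (x : V → ℂ) (i : V) :
    (cliqueTensor t G).apply x i =
      ∑ j ∈ orderedCliques t G i, 1 / ((t - 1).factorial : ℂ) * ∏ r, x (j r) := by
  simp only [Tensor.apply, cliqueTensor, orderedCliques, ite_mul, zero_mul, sum_filter]

theorem norm_eigenvalue_cliqueTensor_le {t : ℕ} {G : SimpleGraph V} {N : ℕ}
    (hN : ∀ i, (orderedCliques t G i).card ≤ N) {lam : ℂ}
    (h : (cliqueTensor t G).IsEigenvalue lam) : ‖lam‖ ≤ N / (t - 1).factorial := by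
  obtain ⟨x, hx, he⟩ := h.exists_norm_eq_one
  have hne : Nonempty V := by
    by_contra hc
    rw [not_nonempty_iff] at hc
    have : x = 0 := Subsingleton.elim _ _
    simp [this] at hx
  obtain ⟨i, hmax⟩ := Finite.exists_max fun i => ‖x i‖
  have hi : ‖x i‖ = 1 := hx ▸
    le_antisymm (norm_le_pi_norm x i) ((pi_norm_le_iff_of_nonneg (norm_nonneg _)).2 hmax)
  have h1 : ‖lam‖ = ‖(cliqueTensor t G).apply x i‖ := by
    rw [he i, norm_mul, norm_pow, hi, one_pow, mul_one]
  rw [h1, apply_cliqueTensor]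
  have h2 : ∀ j ∈ orderedCliques t G i,
      ‖1 / ((t - 1).factorial : ℂ) * ∏ r, x (j r)‖ ≤ 1 / ((t - 1).factorial : ℝ) := by
    intro j _
    rw [norm_mul, norm_prod, norm_div, norm_one, Complex.norm_natCast]
    exact mul_le_of_le_one_right (by positivity)
      (prod_le_one (fun r _ => norm_nonneg _) fun r _ => (norm_le_pi_norm x (j r)).trans hx.le)
  refine (norm_sum_le_of_le _ h2).trans ?_
  rw [sum_const, nsmul_eq_mul, mul_one_div]
  gcongr
  exact hN i

/-- The all-ones vector works, as every vertex lies in equally many cliques. -/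
theorem isEigenvalue_cliqueTensor_top [Nonempty V] {t : ℕ} (ht : 1 ≤ t) :
    (cliqueTensor t (⊤ : SimpleGraph V)).IsEigenvalue
      ((Fintype.card V - 1).descFactorial (t - 1) / (t - 1).factorial) := by
  refine ⟨1, one_ne_zero, fun i => ?_⟩
  simp [apply_cliqueTensor, card_orderedCliques_top ht, div_eq_mul_inv]

end CliqueSpectral

theorem mainTheorem4 {V : Type*} [Fintype V] (n k t : ℕ)
    (hn : k - 1 ≤ n) (hk : 2 ≤ (k + 1) / 2) (hkt : (k + 1) / 2 < t) (htk : t < k)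
    (G : SimpleGraph V) (hV : Fintype.card V = n)
    (hG : (SimpleGraph.pathGraph k).Free G) :
    CliqueSpectral.cliqueSpectralRadius t G ≤
      CliqueSpectral.cliqueSpectralRadius t (⊤ : SimpleGraph (Fin (k - 1))) := by
  classical
  have ht : 1 ≤ t := by omega
  have : Nonempty (Fin (k - 1)) := ⟨⟨0, by omega⟩⟩
  have htop := CliqueSpectral.isEigenvalue_cliqueTensor_top (V := Fin (k - 1)) ht
  have hle : (((k - 1 - 1).descFactorial (t - 1) : ℕ) : ℝ) / ((t - 1).factorial : ℝ) ≤
      CliqueSpectral.cliqueSpectralRadius t (⊤ : SimpleGraph (Fin (k - 1))) := by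
    refine (CliqueSpectral.Tensor.isGreatest_spectralRadius _ ⟨_, htop⟩).2 ⟨_, htop, ?_⟩
    simp
  have hcount : ∀ i, (CliqueSpectral.orderedCliques t G i).card ≤
      (k - 1 - 1).descFactorial (t - 1) := by
    intro i
    -- The degree bound is only available when `i` lies in some `t`-clique.
    obtain h | ⟨j, hj⟩ := (CliqueSpectral.orderedCliques t G i).eq_empty_or_nonempty
    · simp [h]
    · refine (CliqueSpectral.card_orderedCliques_le ht G i).trans (Nat.descFactorial_le _ ?_)
      have := CliqueSpectral.degree_cliqueEdgeGraph_lt hkt hG (CliqueSpectral.mem_orderedCliques.1 hj)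
        (Finset.mem_insert_self i _)
      omega
  -- With a nonnegative bound, no eigenvalue of the tensor of `G` need be exhibited.
  refine le_trans (Real.sSup_le ?_ (by positivity)) hle
  rintro r ⟨lam, hlam, rfl⟩
  exact CliqueSpectral.norm_eigenvalue_cliqueTensor_le hcount hlam
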